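/- Let $\mathcal S,\mathcal Y,\mathcal Z$ be finite sets, let $P$ be a probability distribution on $\mathcal S\times\mathcal Y\times\mathcal Z$, and let $(S,Y,Z)\sim P$. All logarithms are to base $2$. Let $\Delta_P$ be the set of probability distributions $Q$ on $\mathcal S\times\mathcal Y\times\mathcal Z$ with $Q_{SY}=P_{SY}$ and $Q_{SZ}=P_{SZ}$. The minimum-synergy unique information is $$UI(S;Y\backslash Z)=\min_{Q\in\Delta_P} I_Q(S;Y|Z),$$ where $I_Q(S;Y|Z)$ is the conditional mutual information under $Q$. Let $(S^n,Y^n,Z^n)$ be $n$ i.i.d. copies of $(S,Y,Z)$, observed respectively by Alice, Bob and Eve. In a one-way protocol with block length $n$ and key length $m$, Alice computes a key $K_A\in\{0,1\}^m$ and a public message $C$ with values in a finite set as functions of $S^n$, and Bob computes a key $K_B\in\{0,1\}^m$ as a function of $Y^n$ and $C$. A real number $R$ is an achievable rate if there are one-way protocols with block lengths $n=0,1,2,\dots$ and key lengths $m_n$ such that, as $n\to\infty$, $$\Pr[K_A\neq K_B]\to 0,\qquad \log|\{0,1\}^{m_n}|-H(K_A\mid Z^nC)\to 0,\qquad \frac{m_n}{n}\to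 R.$$ The one-way secret key rate $S_{\to}(S;Y|Z)$ is the supremum of the achievable rates. **Theorem.** $S_{\to}(S;Y|Z)\le UI(S;Y\backslash Z)$. The same bound holds for the one-way secret key rate defined with protocols in which Alice and Bob may in addition use private local randomness, that is, $(K_A,C)$ is drawn from a conditional distribution given $S^n$, and $K_B$ is drawn, independently of everything else, from a conditional distribution given $(Y^n,C)$. -/

import Mathlib

open Filter Topology

noncomputable section

namespace KeyRate

/-- Shannon entropy, in bits, of a distribution on a finite set. -/
def entropy {α : Type*} [Fintype α] (p : α → ℝ) : ℝ :=
  (∑ a, Real.negMulLog (p a)) / Real.log 2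

/-- Conditional entropy `H(X|W) = H(X,W) - H(W)`, in bits, of a joint distribution of `(X,W)`. -/
def condEntropy {α β : Type*} [Fintype α] [Fintype β] (p : α × β → ℝ) : ℝ :=
  entropy p - entropy (fun b => ∑ a, p (a, b))

section UniqueInformation

variable {S Y Z : Type*} [Fintype S] [Fintype Y] [Fintype Z]

/-- The `(S,Y)`-marginal. -/
def margSY (Q : S × Y × Z → ℝ) : S × Y → ℝ := fun p => ∑ z, Q (p.1, p.2, z)

/-- The `(S,Z)`-marginal. -/
def margSZ (Q : S × Y × Z → ℝ) : S × Z → ℝ := fun p => ∑ y, Q (p.1, y, p.2)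

/-- The `(Y,Z)`-marginal. -/
def margYZ (Q : S × Y × Z → ℝ) : Y × Z → ℝ := fun p => ∑ s, Q (s, p.1, p.2)

/-- The `Z`-marginal. -/
def margZ (Q : S × Y × Z → ℝ) : Z → ℝ := fun z => ∑ s, ∑ y, Q (s, y, z)

/-- Conditional mutual information
`I_Q(S;Y|Z) = H(S,Z) + H(Y,Z) - H(S,Y,Z) - H(Z)`, in bits. -/
def condMutualInfo (Q : S × Y × Z → ℝ) : ℝ :=
  entropy (margSZ Q) + entropy (margYZ Q) - entropy Q - entropy (margZ Q)

/-- The set `Δ_P` of distributions with the same `(S,Y)`- and `(S,Z)`-marginals as `P`. -/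
def sameMarginals (P : S × Y × Z → ℝ) : Set (S × Y × Z → ℝ) :=
  {Q | Q ∈ stdSimplex ℝ (S × Y × Z) ∧ margSY Q = margSY P ∧ margSZ Q = margSZ P}

/-- Minimum-synergy unique information `UI(S;Y\Z) = min_{Q ∈ Δ_P} I_Q(S;Y|Z)`.
The infimum is attained, see `uniqueInfo_isLeast`. -/
def uniqueInfo (P : S × Y × Z → ℝ) : ℝ := sInf (condMutualInfo '' sameMarginals P)

theorem continuous_entropy {α : Type*} [Fintype α] :
    Continuous (entropy : (α → ℝ) → ℝ) := by
  unfold entropy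
  exact (continuous_finsetSum _ fun a _ =>
    Real.continuous_negMulLog.comp (continuous_apply a)).div_const _

theorem continuous_condMutualInfo :
    Continuous (condMutualInfo : (S × Y × Z → ℝ) → ℝ) := by
  have h1 : Continuous (margSZ : (S × Y × Z → ℝ) → _) := by unfold margSZ; fun_prop
  have h2 : Continuous (margYZ : (S × Y × Z → ℝ) → _) := by unfold margYZ; fun_prop
  have h3 : Continuous (margZ : (S × Y × Z → ℝ) → _) := by unfold margZ; fun_prop
  exact (((continuous_entropy.comp h1).add (continuous_entropy.comp h2)).sub
    continuous_entropy).sub (continuous_entropy.comp h3)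

theorem isCompact_sameMarginals (P : S × Y × Z → ℝ) : IsCompact (sameMarginals P) := by
  have h1 : Continuous (margSY : (S × Y × Z → ℝ) → _) := by unfold margSY; fun_prop
  have h2 : Continuous (margSZ : (S × Y × Z → ℝ) → _) := by unfold margSZ; fun_prop
  exact (isCompact_stdSimplex ℝ (S × Y × Z)).inter_right
    ((isClosed_eq h1 continuous_const).inter (isClosed_eq h2 continuous_const))

/-- The infimum in the definition of `uniqueInfo` is a minimum. -/
theorem uniqueInfo_isLeast (P : S × Y × Z → ℝ) (hP : P ∈ stdSimplex ℝ (S × Y × Z)) :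
    IsLeast (condMutualInfo '' sameMarginals P) (uniqueInfo P) :=
  ((isCompact_sameMarginals P).image continuous_condMutualInfo).isLeast_sInf
    ⟨_, P, ⟨hP, rfl, rfl⟩, rfl⟩

end UniqueInformation

section SecretKey

/-- A one-way secret key agreement protocol with block length `n` and key length `m`, local
randomness being allowed.  Given her observation `sⁿ`, Alice draws a key in `{0,1}^m` and a public
message in a finite alphabet; given `yⁿ` and the message, Bob draws a key in `{0,1}^m`. -/
structure OneWayProtocol (S Y : Type*) (n m : ℕ) where
  /-- size of the message alphabet -/
  msgs : ℕ
  /-- conditional distribution of Alice's key and message given `sⁿ` -/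
  alice : (Fin n → S) → (Fin m → Bool) × Fin msgs → ℝ
  alice_mem : ∀ s, alice s ∈ stdSimplex ℝ ((Fin m → Bool) × Fin msgs)
  /-- conditional distribution of Bob's key given `yⁿ` and the message -/
  bob : (Fin n → Y) → Fin msgs → (Fin m → Bool) → ℝ
  bob_mem : ∀ y c, bob y c ∈ stdSimplex ℝ (Fin m → Bool)

namespace OneWayProtocol

variable {S Y Z : Type*} [Fintype S] [Fintype Y] [Fintype Z] {n m : ℕ}

/-- No local randomness: Alice's key and message are functions of `sⁿ`, and Bob's key is a function
of `yⁿ` and the message. -/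
def IsDeterministic (π : OneWayProtocol S Y n m) : Prop :=
  ∃ (keyA : (Fin n → S) → (Fin m → Bool)) (msg : (Fin n → S) → Fin π.msgs)
    (keyB : (Fin n → Y) → Fin π.msgs → (Fin m → Bool)),
    (∀ s, π.alice s = Pi.single (keyA s, msg s) 1) ∧
    (∀ y c, π.bob y c = Pi.single (keyB y c) 1)

/-- The joint probability of Alice's key `kA`, Bob's key `kB`, Eve's observation `zⁿ` and the public
message `c`, when the protocol is run on `n` i.i.d. copies of `(S,Y,Z) ∼ P`. -/
def law (π : OneWayProtocol S Y n m) (P : S × Y × Z → ℝ)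
    (kA kB : Fin m → Bool) (z : Fin n → Z) (c : Fin π.msgs) : ℝ :=
  ∑ s : Fin n → S, ∑ y : Fin n → Y,
    (∏ i, P (s i, y i, z i)) * π.alice s (kA, c) * π.bob y c kB

/-- The probability that the two keys differ. -/
def errorProb (π : OneWayProtocol S Y n m) (P : S × Y × Z → ℝ) : ℝ :=
  ∑ kA, ∑ kB, if kA ≠ kB then ∑ z, ∑ c, π.law P kA kB z c else 0

/-- Eve's information on the key: `log |{0,1}^m| - H(K_A | Zⁿ C)`, in bits. -/
def leakage (π : OneWayProtocol S Y n m) (P : S × Y × Z → ℝ) : ℝ :=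
  Real.logb 2 (Fintype.card (Fin m → Bool)) -
    condEntropy (fun p : (Fin m → Bool) × ((Fin n → Z) × Fin π.msgs) =>
      ∑ kB, π.law P p.1 kB p.2.1 p.2.2)

end OneWayProtocol

variable {S Y Z : Type*} [Fintype S] [Fintype Y] [Fintype Z]

/-- A sequence of protocols, with block lengths `n = 0, 1, 2, …` and key lengths `m n`, distills
from `P` a secret key at rate `R`. -/
def Distills (P : S × Y × Z → ℝ) {m : ℕ → ℕ} (π : ∀ n, OneWayProtocol S Y n (m n))
    (R : ℝ) : Prop :=
  Tendsto (fun n => (π n).errorProb P) atTop (𝓝 0) ∧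
  Tendsto (fun n => (π n).leakage P) atTop (𝓝 0) ∧
  Tendsto (fun n => (m n : ℝ) / (n : ℝ)) atTop (𝓝 R)

/-- The one-way secret key rate of `P`: the supremum of the rates that can be achieved by protocols
in which keys and message are functions of the observations. -/
def oneWayKeyRate (P : S × Y × Z → ℝ) : EReal :=
  sSup {r : EReal | ∃ (R : ℝ) (m : ℕ → ℕ) (π : ∀ n, OneWayProtocol S Y n (m n)),
    (∀ n, (π n).IsDeterministic) ∧ Distills P π R ∧ r = (R : EReal)}

/-- The one-way secret key rate of `P` when Alice and Bob may in addition use private, independent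
local randomness. -/
def oneWayKeyRateRandomized (P : S × Y × Z → ℝ) : EReal :=
  sSup {r : EReal | ∃ (R : ℝ) (m : ℕ → ℕ) (π : ∀ n, OneWayProtocol S Y n (m n)),
    Distills P π R ∧ r = (R : EReal)}

end SecretKey

end KeyRate

end

set_option linter.unusedSectionVars false

/-! Fix a protocol and vary the source. The law of `(K_A, Zⁿ, C)` involves the source only through
its `(S,Z)`-marginal, since Bob's output is summed away, and the law of `(K_A, K_B)` only through
its `(S,Y)`-marginal, since Eve's observation is. So leakage and error probability are constant on
`Δ_P` (`leakage_congr`, `errorProb_congr`): what distills a key from `P` distills one at the same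
rate from every `Q ∈ Δ_P`. It remains to prove `R ≤ I_Q(S;Y|Z)` for each source `Q` and to take for
`Q` a minimizer.

That bound comes from the one-shot converse `condEntropy_key_le`. With `K = K_A` and `K' = K_B`,
`H(K|ZC) = I(K;Y|ZC) + H(K|YZC) ≤ I(KC;Y|Z) + H(K|YC) ≤ I(S;Y|Z) + H(K|K')`, where the last step
uses the Markov chains `(K,C) – S – (Y,Z)` and `K – (Y,C) – K'`. Fano's inequality bounds `H(K|K')`.
Applied to the i.i.d. source, where conditional mutual information is additive, this gives `m ≤
leakage + n I_Q(S;Y|Z) + 1 + errorProb * m`; dividing by `n` and passing to the limit bounds the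
rate. -/

namespace KeyRate

open Finset

/-! ### Entropy inequalities for distributions on finite sets -/

section Entropy

variable {ι α β : Type*} [Fintype ι] [Fintype α] [Fintype β]

theorem log_two_pos : 0 < Real.log 2 := Real.log_pos (by norm_num)

theorem negMulLog_le_cross {p q : ℝ} (hp : 0 ≤ p) (hq : 0 ≤ q) (h : q = 0 → p = 0) :
    Real.negMulLog p ≤ -p * Real.log q + (q - p) := by
  rcases hp.eq_or_lt with rfl | hp
  · simpa using hq
  have hq : 0 < q := hq.lt_of_ne fun h0 => hp.ne' (h h0.symm)
  have h1 := Real.log_le_sub_one_of_pos (div_pos hq hp)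
  rw [Real.log_div hq.ne' hp.ne'] at h1
  have h2 := mul_le_mul_of_nonneg_left h1 hp.le
  have h3 : p * (q / p - 1) = q - p := by field_simp
  rw [h3] at h2
  unfold Real.negMulLog
  linarith

/-- Gibbs' inequality. -/
theorem sum_negMulLog_le_cross {p q : ι → ℝ} (hp : ∀ i, 0 ≤ p i) (hq : ∀ i, 0 ≤ q i)
    (h : ∀ i, q i = 0 → p i = 0) (hsum : ∑ i, q i ≤ ∑ i, p i) :
    ∑ i, Real.negMulLog (p i) ≤ ∑ i, -p i * Real.log (q i) := by
  calc ∑ i, Real.negMulLog (p i) ≤ ∑ i, (-p i * Real.log (q i) + (q i - p i)) :=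
        sum_le_sum fun i _ => negMulLog_le_cross (hp i) (hq i) (h i)
    _ ≤ _ := by rw [sum_add_distrib, sum_sub_distrib]; linarith

theorem entropy_comp_equiv (e : α ≃ β) (p : β → ℝ) :
    entropy (fun a => p (e a)) = entropy p := by
  unfold entropy
  rw [e.sum_comp fun b => Real.negMulLog (p b)]

/-- Chain rule: adjoining the output of a channel `k` adds the mean entropy of the output. -/
theorem entropy_mul_kernel (p : α → ℝ) (k : α → β → ℝ) (hk : ∀ a, ∑ b, k a b = 1) :
    entropy (fun x : α × β => p x.1 * k x.1 x.2) = entropy p + ∑ a, p a * entropy (k a) := by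
  unfold entropy
  simp only [Real.negMulLog_mul, Fintype.sum_prod_type, sum_add_distrib, ← sum_mul, ← mul_sum, hk,
    one_mul, add_div, sum_div, mul_div_assoc]

/-- Gibbs' inequality against the weight `pB * r`: the factor `pB` contributes exactly the entropy
of the second marginal, which cancels. Here `r` is a guessed conditional (sub)distribution. -/
theorem condEntropy_le_cross {p : α × β → ℝ} (hp : ∀ x, 0 ≤ p x) {r : α × β → ℝ}
    (hr : ∀ x, 0 < r x) (hr1 : ∀ b, ∑ a, r (a, b) ≤ 1) :
    condEntropy p ≤ (∑ x, p x * -Real.log (r x)) / Real.log 2 := by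
  set pB : β → ℝ := fun b => ∑ a, p (a, b) with hpB
  have hpB0 : ∀ b, 0 ≤ pB b := fun b => sum_nonneg fun a _ => hp _
  have hz : ∀ x : α × β, pB x.2 = 0 → p x = 0 := fun x h =>
    (sum_eq_zero_iff_of_nonneg fun a _ => hp (a, x.2)).1 h x.1 (mem_univ _)
  have key := sum_negMulLog_le_cross (p := p) (q := fun x => pB x.2 * r x) hp
    (fun x => mul_nonneg (hpB0 _) (hr x).le)
    (fun x h => hz x ((mul_eq_zero.1 h).resolve_right (hr x).ne'))
    (by
      rw [Fintype.sum_prod_type_right, Fintype.sum_prod_type_right]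
      refine sum_le_sum fun b _ => ?_
      simp only [← mul_sum]
      exact mul_le_of_le_one_right (hpB0 b) (hr1 b))
  have h2 : ∑ x : α × β, -p x * Real.log (pB x.2 * r x)
      = (∑ x, p x * -Real.log (r x)) + ∑ b, Real.negMulLog (pB b) := by
    have : ∀ x : α × β, -p x * Real.log (pB x.2 * r x)
        = p x * -Real.log (r x) + -p x * Real.log (pB x.2) := by
      intro x
      by_cases h : pB x.2 = 0
      · simp [hz x h]
      · rw [Real.log_mul h (hr x).ne']; ring
    rw [sum_congr rfl fun x _ => this x, sum_add_distrib]
    congr 1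
    rw [Fintype.sum_prod_type_right]
    refine sum_congr rfl fun b _ => ?_
    simp only [← sum_mul, sum_neg_distrib, Real.negMulLog, hpB]
  unfold condEntropy entropy
  rw [← sub_div]
  exact div_le_div_of_nonneg_right (by linarith) log_two_pos.le

/-- Fano's inequality. -/
theorem condEntropy_le_fano [DecidableEq α] [Nonempty α] {p : α × α → ℝ} (hp : ∀ x, 0 ≤ p x)
    (hp1 : ∑ x, p x = 1) :
    condEntropy p ≤ 1 + (∑ a, ∑ b, if a ≠ b then p (a, b) else 0) *
      Real.logb 2 (Fintype.card α) := by
  have hc : (0 : ℝ) < Fintype.card α := by exact_mod_cast Fintype.card_pos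
  -- The guess: half the mass on agreement, the rest spread evenly. Agreement costs one bit and
  -- disagreement `1 + log |α|` bits, hence the constant `1` in place of the binary entropy of the
  -- error.
  set r : α × α → ℝ := fun x => if x.1 = x.2 then 1 / 2 else (2 * Fintype.card α)⁻¹ with hr
  refine (condEntropy_le_cross hp (r := r) (fun x => ?_) fun b => ?_).trans_eq ?_
  · simp only [hr]; split_ifs <;> positivity
  · calc ∑ a, r (a, b) ≤ ∑ a, ((if a = b then (1 / 2 : ℝ) else 0) + (2 * Fintype.card α : ℝ)⁻¹) := by
          refine sum_le_sum fun a _ => ?_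
          simp only [hr]
          split_ifs
          · simp
          · simp
      _ = 1 := by
          rw [sum_add_distrib]
          simp
          field_simp
          norm_num
  · have : ∀ x : α × α, p x * -Real.log (r x) =
        p x * Real.log 2 + (if x.1 ≠ x.2 then p x else 0) * Real.log (Fintype.card α) := by
      intro x
      by_cases h : x.1 = x.2
      · simp [hr, h]
      · simp only [hr, h, if_false, ne_eq, not_false_eq_true, if_true, Real.log_inv,
          Real.log_mul two_ne_zero hc.ne']
        ring
    rw [sum_congr rfl fun x _ => this x, sum_add_distrib, ← sum_mul, ← sum_mul, hp1,
      Fintype.sum_prod_type, Real.logb, add_div, one_mul, div_self log_two_pos.ne', mul_div_assoc]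

theorem entropy_prod_iid {p : α → ℝ} (hp : ∑ a, p a = 1) (n : ℕ) :
    entropy (fun x : Fin n → α => ∏ i, p (x i)) = n * entropy p := by
  induction n with
  | zero => simp [entropy]
  | succ n ih =>
    have hs : ∑ x : Fin n → α, ∏ i, p (x i) = 1 := by
      rw [← Fintype.prod_sum fun _ : Fin n => p]
      simp [hp]
    rw [← entropy_comp_equiv (Fin.consEquiv fun _ : Fin (n + 1) => α)]
    simp only [Fin.consEquiv_apply, Fin.prod_univ_succ, Fin.cons_zero, Fin.cons_succ]
    rw [entropy_mul_kernel p (fun _ (x : Fin n → α) => ∏ i, p (x i)) fun _ => hs, ih, ← sum_mul, hp]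
    push_cast
    ring

theorem sum_triple {S Y Z : Type*} [Fintype S] [Fintype Y] [Fintype Z] (f : S × Y × Z → ℝ) :
    ∑ x, f x = ∑ z, ∑ s, ∑ y, f (s, y, z) := by
  simp only [Fintype.sum_prod_type]
  exact (sum_congr rfl fun s _ => sum_comm).trans sum_comm

/-- Gibbs' inequality against `Q_SZ * Q_YZ / Q_Z`, the law with the same pair marginals in which `S`
and `Y` are independent given `Z`. -/
theorem condMutualInfo_nonneg {S Y Z : Type*} [Fintype S] [Fintype Y] [Fintype Z]
    {Q : S × Y × Z → ℝ} (hQ : ∀ x, 0 ≤ Q x) : 0 ≤ condMutualInfo Q := by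
  have nSZ : ∀ x, 0 ≤ margSZ Q x := fun x => sum_nonneg fun _ _ => hQ _
  have nYZ : ∀ x, 0 ≤ margYZ Q x := fun x => sum_nonneg fun _ _ => hQ _
  have nZ : ∀ x, 0 ≤ margZ Q x := fun x => sum_nonneg fun _ _ => sum_nonneg fun _ _ => hQ _
  have zSZ : ∀ s y z, margSZ Q (s, z) = 0 → Q (s, y, z) = 0 := fun s y z h =>
    (sum_eq_zero_iff_of_nonneg fun _ _ => hQ _).1 h y (mem_univ _)
  have zYZ : ∀ s y z, margYZ Q (y, z) = 0 → Q (s, y, z) = 0 := fun s y z h =>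
    (sum_eq_zero_iff_of_nonneg fun _ _ => hQ _).1 h s (mem_univ _)
  have sSZ : ∀ z, ∑ s, margSZ Q (s, z) = margZ Q z := fun z => rfl
  have sYZ : ∀ z, ∑ y, margYZ Q (y, z) = margZ Q z := fun z => sum_comm
  have zZ : ∀ s y z, margZ Q z = 0 → Q (s, y, z) = 0 := fun s y z h =>
    zSZ s y z ((sum_eq_zero_iff_of_nonneg fun s _ => nSZ (s, z)).1 ((sSZ z).trans h) s (mem_univ _))
  have key := sum_negMulLog_le_cross (p := Q)
    (q := fun x => margSZ Q (x.1, x.2.2) * margYZ Q x.2 / margZ Q x.2.2) hQ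
    (fun x => div_nonneg (mul_nonneg (nSZ _) (nYZ _)) (nZ _))
    (by
      rintro ⟨s, y, z⟩ h
      rcases div_eq_zero_iff.1 h with h | h
      · rcases mul_eq_zero.1 h with h | h
        · exact zSZ s y z h
        · exact zYZ s y z h
      · exact zZ s y z h)
    (by
      -- Above each `z` the product weight has mass `Q_Z(z)² / Q_Z(z)`, which equals `Q_Z(z)` even
      -- at null `z`, as division by zero gives zero.
      apply le_of_eq
      rw [sum_triple, sum_triple Q]
      refine sum_congr rfl fun z _ => ?_
      simp only [← sum_div, ← mul_sum, ← sum_mul, sSZ, sYZ]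
      exact mul_self_div_self _)
  have h2 : ∑ x : S × Y × Z, -Q x * Real.log (margSZ Q (x.1, x.2.2) * margYZ Q x.2 / margZ Q x.2.2)
      = ∑ x, Real.negMulLog (margSZ Q x) + ∑ x, Real.negMulLog (margYZ Q x)
        - ∑ x, Real.negMulLog (margZ Q x) := by
    have : ∀ s y z, -Q (s, y, z) * Real.log (margSZ Q (s, z) * margYZ Q (y, z) / margZ Q z)
        = -Q (s, y, z) * Real.log (margSZ Q (s, z)) + -Q (s, y, z) * Real.log (margYZ Q (y, z))
          - -Q (s, y, z) * Real.log (margZ Q z) := by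
      intro s y z
      by_cases h : Q (s, y, z) = 0
      · simp [h]
      · rw [Real.log_div (mul_ne_zero (mt (zSZ s y z) h) (mt (zYZ s y z) h)) (mt (zZ s y z) h),
          Real.log_mul (mt (zSZ s y z) h) (mt (zYZ s y z) h)]
        ring
    rw [sum_triple]
    simp only [this, sum_add_distrib, sum_sub_distrib]
    congr 1
    · congr 1
      · rw [Fintype.sum_prod_type_right]
        simp only [← sum_mul, sum_neg_distrib, Real.negMulLog, margSZ]
      · rw [Fintype.sum_prod_type_right]
        refine sum_congr rfl fun z _ => ?_
        rw [sum_comm]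
        simp only [← sum_mul, sum_neg_distrib, Real.negMulLog, margYZ]
    · simp only [← sum_mul, sum_neg_distrib, Real.negMulLog, margZ]
  unfold condMutualInfo entropy
  rw [← add_div, ← sub_div, ← sub_div]
  exact div_nonneg (by linarith) log_two_pos.le

end Entropy

/-! ### Entropies of random variables on a finite probability space -/

section RandomVariable

variable {Ω α β γ : Type*} [Fintype Ω]

open Classical in
/-- The law of the random variable `X` on the finite probability space `(Ω, p)`. -/
noncomputable def rvLaw (p : Ω → ℝ) (X : Ω → α) (a : α) : ℝ := ∑ ω, if X ω = a then p ω else 0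

/-- Entropy, in bits, of a random variable. -/
noncomputable def rvEntropy [Fintype α] (p : Ω → ℝ) (X : Ω → α) : ℝ := entropy (rvLaw p X)

theorem rvLaw_nonneg {p : Ω → ℝ} (hp : ∀ ω, 0 ≤ p ω) (X : Ω → α) (a : α) : 0 ≤ rvLaw p X a :=
  sum_nonneg fun ω _ => by split_ifs <;> simp [hp]

theorem rvLaw_congr (p : Ω → ℝ) {X : Ω → α} {Y : Ω → β} {a : α} {b : β}
    (h : ∀ ω, X ω = a ↔ Y ω = b) : rvLaw p X a = rvLaw p Y b := by
  classical
  unfold rvLaw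
  exact sum_congr rfl fun ω _ => if_congr (h ω) rfl rfl

variable [Fintype α]

theorem sum_rvLaw (p : Ω → ℝ) (X : Ω → α) : ∑ a, rvLaw p X a = ∑ ω, p ω := by
  classical
  unfold rvLaw
  rw [sum_comm]
  simp

theorem sum_rvLaw_fst (p : Ω → ℝ) (X : Ω → α) (Y : Ω → β) (b : β) :
    ∑ a, rvLaw p (fun ω => (X ω, Y ω)) (a, b) = rvLaw p Y b := by
  classical
  unfold rvLaw
  rw [sum_comm]
  simp [Prod.ext_iff, ite_and]

theorem sum_rvLaw_mul (p : Ω → ℝ) (X : Ω → α) (g : α → ℝ) :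
    ∑ a, rvLaw p X a * g a = ∑ ω, p ω * g (X ω) := by
  classical
  simp only [rvLaw, sum_mul, ite_mul, zero_mul]
  rw [sum_comm]
  simp

variable [Fintype β] [Fintype γ]

theorem condEntropy_rvLaw (p : Ω → ℝ) (X : Ω → α) (Y : Ω → β) :
    condEntropy (rvLaw p fun ω => (X ω, Y ω)) =
      rvEntropy p (fun ω => (X ω, Y ω)) - rvEntropy p Y := by
  simp only [condEntropy, sum_rvLaw_fst, rvEntropy]

/-- Chain rule for a random variable `W` drawn from `X` through the channel `k`. -/
theorem rvEntropy_kernel (p : Ω → ℝ) (X : Ω → α) (W : Ω → β) (k : α → β → ℝ)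
    (hk : ∀ a, ∑ b, k a b = 1)
    (h : ∀ a b, rvLaw p (fun ω => (X ω, W ω)) (a, b) = rvLaw p X a * k a b) :
    rvEntropy p (fun ω => (X ω, W ω)) = rvEntropy p X + ∑ ω, p ω * entropy (k (X ω)) := by
  rw [← sum_rvLaw_mul p X fun a => entropy (k a)]
  unfold rvEntropy
  rw [← entropy_mul_kernel _ _ hk]
  exact congrArg entropy (funext fun x => h x.1 x.2)

/-- Entropy as a mean over the sample space: the values of `X` enter only through the mass of the
fibre containing `ω`. Regrouping the components of a tuple thus leaves its entropy unchanged. -/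
theorem rvEntropy_eq_sum (p : Ω → ℝ) (X : Ω → α) :
    rvEntropy p X = (∑ ω, -p ω * Real.log (rvLaw p X (X ω))) / Real.log 2 := by
  classical
  unfold rvEntropy entropy
  congr 1
  have : ∀ a, Real.negMulLog (rvLaw p X a) =
      ∑ ω, if X ω = a then -p ω * Real.log (rvLaw p X a) else 0 := by
    intro a
    rw [Real.negMulLog, neg_mul]
    conv_lhs => enter [1, 1]; rw [rvLaw]
    rw [sum_mul, ← sum_neg_distrib]
    refine sum_congr rfl fun ω _ => ?_
    split_ifs <;> simp
  rw [sum_congr rfl fun a _ => this a, sum_comm]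
  simp

/-- The entropy of a random variable depends only on the partition it induces. -/
theorem rvEntropy_congr (p : Ω → ℝ) {X : Ω → α} {Y : Ω → β}
    (h : ∀ ω ω', X ω = X ω' ↔ Y ω = Y ω') : rvEntropy p X = rvEntropy p Y := by
  have : ∀ ω, rvLaw p X (X ω) = rvLaw p Y (Y ω) := fun ω => rvLaw_congr p fun ω' => h ω' ω
  simp only [rvEntropy_eq_sum, this]

theorem margYZ_rvLaw (p : Ω → ℝ) (X : Ω → α) (Y : Ω → β) (Z : Ω → γ) :
    margYZ (rvLaw p fun ω => (X ω, Y ω, Z ω)) = rvLaw p fun ω => (Y ω, Z ω) :=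
  funext fun x => sum_rvLaw_fst p X (fun ω => (Y ω, Z ω)) x

theorem margSZ_rvLaw (p : Ω → ℝ) (X : Ω → α) (Y : Ω → β) (Z : Ω → γ) :
    margSZ (rvLaw p fun ω => (X ω, Y ω, Z ω)) = rvLaw p fun ω => (X ω, Z ω) := by
  funext x
  rw [← sum_rvLaw_fst p Y]
  refine sum_congr rfl fun y _ => rvLaw_congr p fun ω => ?_
  simp only [Prod.ext_iff]
  tauto

theorem margZ_rvLaw (p : Ω → ℝ) (X : Ω → α) (Y : Ω → β) (Z : Ω → γ) :
    margZ (rvLaw p fun ω => (X ω, Y ω, Z ω)) = rvLaw p Z := by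
  funext z
  rw [← sum_rvLaw_fst p X, ← margSZ_rvLaw p X Y Z]
  rfl

/-- Submodularity of entropy. -/
theorem rvEntropy_submodular {p : Ω → ℝ} (hp : ∀ ω, 0 ≤ p ω) (X : Ω → α) (Y : Ω → β) (Z : Ω → γ) :
    rvEntropy p (fun ω => (X ω, Y ω, Z ω)) + rvEntropy p Z ≤
      rvEntropy p (fun ω => (X ω, Z ω)) + rvEntropy p (fun ω => (Y ω, Z ω)) := by
  have h := condMutualInfo_nonneg (rvLaw_nonneg hp fun ω => (X ω, Y ω, Z ω))
  rw [condMutualInfo, margYZ_rvLaw, margSZ_rvLaw, margZ_rvLaw] at h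
  unfold rvEntropy
  linarith

end RandomVariable

/-! ### The one-shot converse -/

section Converse

variable {S Y Z K C : Type*} [Fintype K] [Fintype C]

/-- Joint law of sources, Alice's key and message, and Bob's key. -/
def jointLaw (q : S × Y × Z → ℝ) (a : S → K × C → ℝ) (b : Y → C → K → ℝ) :
    S × Y × Z × (K × C) × K → ℝ :=
  fun ω => q (ω.1, ω.2.1, ω.2.2.1) * a ω.1 ω.2.2.2.1 * b ω.2.1 ω.2.2.2.1.2 ω.2.2.2.2

theorem jointLaw_nonneg {q : S × Y × Z → ℝ} {a : S → K × C → ℝ} {b : Y → C → K → ℝ}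
    (hq : ∀ x, 0 ≤ q x) (ha : ∀ s, a s ∈ stdSimplex ℝ (K × C))
    (hb : ∀ y c, b y c ∈ stdSimplex ℝ K) (ω : S × Y × Z × (K × C) × K) :
    0 ≤ jointLaw q a b ω :=
  mul_nonneg (mul_nonneg (hq _) ((ha _).1 _)) ((hb _ _).1 _)

variable [Fintype S] [Fintype Y] [Fintype Z]

section Laws

variable (q : S × Y × Z → ℝ) {a : S → K × C → ℝ} {b : Y → C → K → ℝ}

theorem rvLaw_source_alice (a : S → K × C → ℝ) (hb : ∀ y c, b y c ∈ stdSimplex ℝ K)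
    (x : S × Y × Z) (w : K × C) :
    rvLaw (jointLaw q a b) (fun ω => ((ω.1, ω.2.1, ω.2.2.1), ω.2.2.2.1)) (x, w) =
      q x * a x.1 w := by
  classical
  obtain ⟨s, y, z⟩ := x
  obtain ⟨k, c⟩ := w
  simp only [rvLaw, jointLaw, Fintype.sum_prod_type, Prod.mk.injEq, ite_and, sum_ite_irrel,
    sum_const_zero, sum_ite_eq', mem_univ, if_true, ← mul_sum, (hb _ _).2, mul_one]

theorem rvLaw_source (ha : ∀ s, a s ∈ stdSimplex ℝ (K × C)) (hb : ∀ y c, b y c ∈ stdSimplex ℝ K) :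
    rvLaw (jointLaw q a b) (fun ω => (ω.1, ω.2.1, ω.2.2.1)) = q := by
  funext x
  have h := fun w => rvLaw_source_alice q a hb x w
  have h2 := sum_rvLaw_fst (jointLaw q a b) (fun ω => ω.2.2.2.1)
    (fun ω => (ω.1, ω.2.1, ω.2.2.1)) x
  rw [← h2]
  calc _ = ∑ w, q x * a x.1 w := sum_congr rfl fun w _ => by
        rw [← h w]
        exact rvLaw_congr _ fun ω => by simp only [Prod.ext_iff]; tauto
    _ = q x := by rw [← mul_sum, (ha _).2, mul_one]

theorem rvLaw_SZ (ha : ∀ s, a s ∈ stdSimplex ℝ (K × C)) (hb : ∀ y c, b y c ∈ stdSimplex ℝ K) :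
    rvLaw (jointLaw q a b) (fun ω => (ω.1, ω.2.2.1)) = margSZ q := by
  conv_rhs => rw [← rvLaw_source q ha hb]
  exact (margSZ_rvLaw ..).symm

theorem rvLaw_YZ (ha : ∀ s, a s ∈ stdSimplex ℝ (K × C)) (hb : ∀ y c, b y c ∈ stdSimplex ℝ K) :
    rvLaw (jointLaw q a b) (fun ω => (ω.2.1, ω.2.2.1)) = margYZ q := by
  conv_rhs => rw [← rvLaw_source q ha hb]
  exact (margYZ_rvLaw ..).symm

theorem rvLaw_Z (ha : ∀ s, a s ∈ stdSimplex ℝ (K × C)) (hb : ∀ y c, b y c ∈ stdSimplex ℝ K) :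
    rvLaw (jointLaw q a b) (fun ω => ω.2.2.1) = margZ q := by
  conv_rhs => rw [← rvLaw_source q ha hb]
  exact (margZ_rvLaw ..).symm

/-- Together with `rvLaw_source_alice`, this is the Markov chain `(K,C) – S – (Y,Z)`: with or
without `Y`, Alice's output comes from the same channel. -/
theorem rvLaw_SZ_alice (a : S → K × C → ℝ) (hb : ∀ y c, b y c ∈ stdSimplex ℝ K)
    (x : S × Z) (w : K × C) :
    rvLaw (jointLaw q a b) (fun ω => ((ω.1, ω.2.2.1), ω.2.2.2.1)) (x, w) =
      margSZ q x * a x.1 w := by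
  classical
  obtain ⟨s, z⟩ := x
  obtain ⟨k, c⟩ := w
  simp only [rvLaw, jointLaw, margSZ, Fintype.sum_prod_type, Prod.mk.injEq, ite_and, sum_ite_irrel,
    sum_const_zero, sum_ite_eq', mem_univ, if_true, ← mul_sum, (hb _ _).2, mul_one, sum_mul]

/-- Together with `rvLaw_YC_bob`, this is the Markov chain `K – (Y,C) – K'`: Alice's key does not
affect Bob's channel. -/
theorem rvLaw_key_YC_bob (a : S → K × C → ℝ) (hb : ∀ y c, b y c ∈ stdSimplex ℝ K)
    (x : K × Y × C) (k' : K) :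
    rvLaw (jointLaw q a b) (fun ω => ((ω.2.2.2.1.1, ω.2.1, ω.2.2.2.1.2), ω.2.2.2.2)) (x, k') =
      rvLaw (jointLaw q a b) (fun ω => (ω.2.2.2.1.1, ω.2.1, ω.2.2.2.1.2)) x * b x.2.1 x.2.2 k' := by
  classical
  obtain ⟨k, y, c⟩ := x
  simp only [rvLaw, jointLaw, Fintype.sum_prod_type, Prod.mk.injEq, ite_and, sum_ite_irrel,
    sum_const_zero, sum_ite_eq', mem_univ, if_true, ← mul_sum, (hb _ _).2, mul_one]
  simp only [sum_mul]

theorem rvLaw_YC_bob (a : S → K × C → ℝ) (hb : ∀ y c, b y c ∈ stdSimplex ℝ K)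
    (x : Y × C) (k' : K) :
    rvLaw (jointLaw q a b) (fun ω => ((ω.2.1, ω.2.2.2.1.2), ω.2.2.2.2)) (x, k') =
      rvLaw (jointLaw q a b) (fun ω => (ω.2.1, ω.2.2.2.1.2)) x * b x.1 x.2 k' := by
  classical
  obtain ⟨y, c⟩ := x
  simp only [rvLaw, jointLaw, Fintype.sum_prod_type, Prod.mk.injEq, ite_and, sum_ite_irrel,
    sum_const_zero, sum_ite_eq', mem_univ, if_true, ← mul_sum, (hb _ _).2, mul_one]
  simp only [sum_mul, mul_sum]

theorem rvLaw_keys (a : S → K × C → ℝ) (b : Y → C → K → ℝ) (k k' : K) :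
    rvLaw (jointLaw q a b) (fun ω => (ω.2.2.2.1.1, ω.2.2.2.2)) (k, k') =
      ∑ z, ∑ c, ∑ s, ∑ y, q (s, y, z) * a s (k, c) * b y c k' := by
  classical
  simp only [rvLaw, jointLaw, Fintype.sum_prod_type, Prod.mk.injEq, ite_and, sum_ite_irrel,
    sum_const_zero, sum_ite_eq', mem_univ, if_true]
  calc _ = ∑ s, ∑ z, ∑ c, ∑ y, q (s, y, z) * a s (k, c) * b y c k' :=
        sum_congr rfl fun s _ => sum_comm.trans (sum_congr rfl fun z _ => sum_comm)
    _ = _ := sum_comm.trans (sum_congr rfl fun z _ => sum_comm)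

theorem rvLaw_key_ZC (a : S → K × C → ℝ) (b : Y → C → K → ℝ) (x : K × Z × C) :
    rvLaw (jointLaw q a b) (fun ω => (ω.2.2.2.1.1, ω.2.2.1, ω.2.2.2.1.2)) x =
      ∑ k', ∑ s, ∑ y, q (s, y, x.2.1) * a s (x.1, x.2.2) * b y x.2.2 k' := by
  classical
  obtain ⟨k, z, c⟩ := x
  simp only [rvLaw, jointLaw, Fintype.sum_prod_type, Prod.mk.injEq, ite_and, sum_ite_irrel,
    sum_const_zero, sum_ite_eq', mem_univ, if_true]
  exact ((sum_congr rfl fun s _ => sum_comm).trans sum_comm)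

end Laws

/-- One-shot converse: Eve's equivocation about Alice's key is at most the conditional mutual
information of the sources plus a Fano term. -/
theorem condEntropy_key_le [DecidableEq K] [Nonempty K] {q : S × Y × Z → ℝ}
    (hq : q ∈ stdSimplex ℝ (S × Y × Z)) {a : S → K × C → ℝ} {b : Y → C → K → ℝ}
    (ha : ∀ s, a s ∈ stdSimplex ℝ (K × C)) (hb : ∀ y c, b y c ∈ stdSimplex ℝ K) :
    condEntropy (fun x : K × (Z × C) =>
        ∑ k', ∑ s, ∑ y, q (s, y, x.2.1) * a s (x.1, x.2.2) * b y x.2.2 k') ≤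
      condMutualInfo q + 1 +
        (∑ k, ∑ k', if k ≠ k' then
          ∑ z, ∑ c, ∑ s, ∑ y, q (s, y, z) * a s (k, c) * b y c k' else 0) *
          Real.logb 2 (Fintype.card K) := by
  have hp := jointLaw_nonneg hq.1 ha hb
  have hp1 : ∑ ω, jointLaw q a b ω = 1 := by
    rw [← sum_rvLaw _ fun ω => (ω.1, ω.2.1, ω.2.2.1), rvLaw_source q ha hb, hq.2]
  simp only [← rvLaw_key_ZC, ← rvLaw_keys]
  set p := jointLaw q a b with hpdef
  let s : S × Y × Z × (K × C) × K → S := fun ω => ω.1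
  let y : S × Y × Z × (K × C) × K → Y := fun ω => ω.2.1
  let z : S × Y × Z × (K × C) × K → Z := fun ω => ω.2.2.1
  let k : S × Y × Z × (K × C) × K → K := fun ω => ω.2.2.2.1.1
  let c : S × Y × Z × (K × C) × K → C := fun ω => ω.2.2.2.1.2
  let k' : S × Y × Z × (K × C) × K → K := fun ω => ω.2.2.2.2
  have hfano := condEntropy_le_fano (rvLaw_nonneg hp fun ω => (k ω, k' ω)) ((sum_rvLaw _ _).trans hp1)
  rw [condEntropy_rvLaw] at hfano
  have hleft := condEntropy_rvLaw p k fun ω => (z ω, c ω)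
  have hinfo : condMutualInfo q = rvEntropy p (fun ω => (s ω, z ω)) +
      rvEntropy p (fun ω => (y ω, z ω)) - rvEntropy p (fun ω => (s ω, y ω, z ω)) -
      rvEntropy p z := by
    simp only [condMutualInfo, rvEntropy, p, s, y, z]
    rw [rvLaw_source q ha hb, rvLaw_SZ q ha hb, rvLaw_YZ q ha hb, rvLaw_Z q ha hb]
  -- `hsource` and `hSZ` carry the same mean channel entropy, so their difference says `H(KC|SYZ) =
  -- H(KC|SZ)`. In the same way `hKYC` and `hYC` give `H(K'|KYC) = H(K'|YC)`.
  have hsource := rvEntropy_kernel p (fun ω => (s ω, y ω, z ω)) (fun ω => (k ω, c ω))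
    (fun x => a x.1) (fun x => (ha x.1).2)
    (fun x w => by
      rw [rvLaw_source q ha hb]
      exact rvLaw_source_alice q a hb x w)
  have hSZ := rvEntropy_kernel p (fun ω => (s ω, z ω)) (fun ω => (k ω, c ω))
    (fun x => a x.1) (fun x => (ha x.1).2)
    (fun x w => by
      rw [rvLaw_SZ q ha hb]
      exact rvLaw_SZ_alice q a hb x w)
  have hKYC := rvEntropy_kernel p (fun ω => (k ω, y ω, c ω)) k'
    (fun x => b x.2.1 x.2.2) (fun x => (hb _ _).2) (rvLaw_key_YC_bob q a hb)
  have hYC := rvEntropy_kernel p (fun ω => (y ω, c ω)) k'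
    (fun x => b x.1 x.2) (fun x => (hb _ _).2) (rvLaw_YC_bob q a hb)
  -- In order: `H(K|YZC) ≤ H(K|YC)`, `I(Y;C|Z) ≥ 0`, `I(S;Y|ZKC) ≥ 0` and `H(K|YCK') ≤ H(K|K')`.
  have sub1 := rvEntropy_submodular hp k z fun ω => (y ω, c ω)
  have sub2 := rvEntropy_submodular hp y c z
  have sub3 := rvEntropy_submodular hp s y fun ω => (z ω, k ω, c ω)
  have sub4 := rvEntropy_submodular hp k (fun ω => (y ω, c ω)) k'
  have e1 : rvEntropy p (fun ω => (k ω, z ω, y ω, c ω)) =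
      rvEntropy p (fun ω => (y ω, z ω, k ω, c ω)) :=
    rvEntropy_congr p fun ω ω' => by simp only [Prod.mk.injEq]; tauto
  have e2 : rvEntropy p (fun ω => (z ω, y ω, c ω)) = rvEntropy p (fun ω => (y ω, c ω, z ω)) :=
    rvEntropy_congr p fun ω ω' => by simp only [Prod.mk.injEq]; tauto
  have e3 : rvEntropy p (fun ω => (z ω, k ω, c ω)) = rvEntropy p (fun ω => (k ω, z ω, c ω)) :=
    rvEntropy_congr p fun ω ω' => by simp only [Prod.mk.injEq]; tauto
  have e4 : rvEntropy p (fun ω => (s ω, y ω, z ω, k ω, c ω)) =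
      rvEntropy p (fun ω => ((s ω, y ω, z ω), k ω, c ω)) :=
    rvEntropy_congr p fun ω ω' => by simp only [Prod.mk.injEq]; tauto
  have e5 : rvEntropy p (fun ω => (s ω, z ω, k ω, c ω)) =
      rvEntropy p (fun ω => ((s ω, z ω), k ω, c ω)) :=
    rvEntropy_congr p fun ω ω' => by simp only [Prod.mk.injEq]; tauto
  have e6 : rvEntropy p (fun ω => (k ω, (y ω, c ω), k' ω)) =
      rvEntropy p (fun ω => ((k ω, y ω, c ω), k' ω)) :=
    rvEntropy_congr p fun ω ω' => by simp only [Prod.mk.injEq]; tauto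
  have e7 : rvEntropy p (fun ω => (c ω, z ω)) = rvEntropy p (fun ω => (z ω, c ω)) :=
    rvEntropy_congr p fun ω ω' => by simp only [Prod.mk.injEq]; tauto
  change condEntropy (rvLaw p fun ω => (k ω, z ω, c ω)) ≤ _
  linarith

end Converse

/-! ### Additivity of conditional mutual information over i.i.d. copies -/

section Product

variable {S Y Z : Type*} [Fintype S] [Fintype Y] [Fintype Z]

/-- The law of `n` i.i.d. copies of `(S,Y,Z) ∼ Q`. -/
def iidLaw (n : ℕ) (Q : S × Y × Z → ℝ) : (Fin n → S) × (Fin n → Y) × (Fin n → Z) → ℝ :=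
  fun x => ∏ i, Q (x.1 i, x.2.1 i, x.2.2 i)

/-- Tuples of pairs are pairs of tuples. -/
def tuplePairEquiv (n : ℕ) (α β : Type*) : (Fin n → α) × (Fin n → β) ≃ (Fin n → α × β) where
  toFun x i := (x.1 i, x.2 i)
  invFun x := (fun i => (x i).1, fun i => (x i).2)
  left_inv _ := rfl
  right_inv _ := rfl

/-- Tuples of triples are triples of tuples. -/
def tupleTripleEquiv (n : ℕ) (α β γ : Type*) :
    (Fin n → α) × (Fin n → β) × (Fin n → γ) ≃ (Fin n → α × β × γ) where
  toFun x i := (x.1 i, x.2.1 i, x.2.2 i)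
  invFun x := (fun i => (x i).1, fun i => (x i).2.1, fun i => (x i).2.2)
  left_inv _ := rfl
  right_inv _ := rfl

theorem iidLaw_mem_stdSimplex {Q : S × Y × Z → ℝ} (hQ : Q ∈ stdSimplex ℝ (S × Y × Z)) (n : ℕ) :
    iidLaw n Q ∈ stdSimplex ℝ ((Fin n → S) × (Fin n → Y) × (Fin n → Z)) := by
  refine ⟨fun x => prod_nonneg fun i _ => hQ.1 _, ?_⟩
  calc ∑ x, iidLaw n Q x = ∑ x : Fin n → S × Y × Z, ∏ i, Q (x i) :=
        (tupleTripleEquiv n S Y Z).sum_comp fun x => ∏ i, Q (x i)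
    _ = 1 := by
        rw [← Fintype.prod_sum fun _ : Fin n => Q]
        simp [hQ.2]

theorem margSY_iidLaw (Q : S × Y × Z → ℝ) (n : ℕ) (x : (Fin n → S) × (Fin n → Y)) :
    margSY (iidLaw n Q) x = ∏ i, margSY Q (x.1 i, x.2 i) :=
  (Fintype.prod_sum fun i z => Q (x.1 i, x.2 i, z)).symm

theorem margSZ_iidLaw (Q : S × Y × Z → ℝ) (n : ℕ) (x : (Fin n → S) × (Fin n → Z)) :
    margSZ (iidLaw n Q) x = ∏ i, margSZ Q (x.1 i, x.2 i) :=
  (Fintype.prod_sum fun i y => Q (x.1 i, y, x.2 i)).symm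

theorem margYZ_iidLaw (Q : S × Y × Z → ℝ) (n : ℕ) (x : (Fin n → Y) × (Fin n → Z)) :
    margYZ (iidLaw n Q) x = ∏ i, margYZ Q (x.1 i, x.2 i) :=
  (Fintype.prod_sum fun i s => Q (s, x.1 i, x.2 i)).symm

theorem margZ_iidLaw (Q : S × Y × Z → ℝ) (n : ℕ) (z : Fin n → Z) :
    margZ (iidLaw n Q) z = ∏ i, margZ Q (z i) := by
  change ∑ s, margSZ (iidLaw n Q) (s, z) = ∏ i, ∑ s, margSZ Q (s, z i)
  simp only [margSZ_iidLaw]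
  exact (Fintype.prod_sum fun i s => margSZ Q (s, z i)).symm

theorem condMutualInfo_iidLaw {Q : S × Y × Z → ℝ} (hQ : ∑ x, Q x = 1) (n : ℕ) :
    condMutualInfo (iidLaw n Q) = n * condMutualInfo Q := by
  have hZ : ∑ z, margZ Q z = 1 := by rw [← hQ, sum_triple]; rfl
  have hSZ : ∑ x, margSZ Q x = 1 := by rw [← hZ, Fintype.sum_prod_type_right]; rfl
  have hYZ : ∑ x, margYZ Q x = 1 := by
    rw [← hZ, Fintype.sum_prod_type_right]
    exact sum_congr rfl fun z _ => sum_comm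
  have eZ : entropy (margZ (iidLaw n Q)) = n * entropy (margZ Q) := by
    rw [← entropy_prod_iid hZ]
    exact congrArg entropy (funext (margZ_iidLaw Q n))
  have eSZ : entropy (margSZ (iidLaw n Q)) = n * entropy (margSZ Q) := by
    rw [← entropy_prod_iid hSZ, ← entropy_comp_equiv (tuplePairEquiv n S Z)]
    exact congrArg entropy (funext (margSZ_iidLaw Q n))
  have eYZ : entropy (margYZ (iidLaw n Q)) = n * entropy (margYZ Q) := by
    rw [← entropy_prod_iid hYZ, ← entropy_comp_equiv (tuplePairEquiv n Y Z)]
    exact congrArg entropy (funext (margYZ_iidLaw Q n))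
  have e : entropy (iidLaw n Q) = n * entropy Q := by
    rw [← entropy_prod_iid hQ, ← entropy_comp_equiv (tupleTripleEquiv n S Y Z)]
    rfl
  simp only [condMutualInfo, eZ, eSZ, eYZ, e]
  ring

end Product

/-! ### Dependence of a protocol's performance on the marginals of the source -/

namespace OneWayProtocol

variable {S Y Z : Type*} [Fintype S] [Fintype Y] [Fintype Z] {n m : ℕ}

theorem sum_bob_law (π : OneWayProtocol S Y n m) (P : S × Y × Z → ℝ)
    (kA : Fin m → Bool) (z : Fin n → Z) (c : Fin π.msgs) :
    ∑ kB, π.law P kA kB z c = ∑ s, (∏ i, margSZ P (s i, z i)) * π.alice s (kA, c) := by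
  unfold law
  rw [sum_comm]
  refine sum_congr rfl fun s _ => ?_
  rw [sum_comm]
  simp only [← mul_sum, (π.bob_mem _ _).2, mul_one]
  rw [← sum_mul, ← margSZ_iidLaw P n (s, z)]
  rfl

theorem sum_eve_law (π : OneWayProtocol S Y n m) (P : S × Y × Z → ℝ)
    (kA kB : Fin m → Bool) :
    ∑ z, ∑ c, π.law P kA kB z c = ∑ c, ∑ s : Fin n → S, ∑ y : Fin n → Y,
      (∏ i, margSY P (s i, y i)) * π.alice s (kA, c) * π.bob y c kB := by
  unfold law
  rw [sum_comm]
  refine sum_congr rfl fun c _ => ?_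
  rw [sum_comm]
  refine sum_congr rfl fun s _ => ?_
  rw [sum_comm]
  refine sum_congr rfl fun y _ => ?_
  rw [← sum_mul, ← sum_mul, ← margSY_iidLaw P n (s, y)]
  rfl

/-- The leakage depends on the source only through its `(S,Z)`-marginal. -/
theorem leakage_congr (π : OneWayProtocol S Y n m) {P Q : S × Y × Z → ℝ}
    (h : margSZ Q = margSZ P) : π.leakage Q = π.leakage P := by
  simp only [leakage, sum_bob_law, h]

/-- The error probability depends on the source only through its `(S,Y)`-marginal. -/
theorem errorProb_congr (π : OneWayProtocol S Y n m) {P Q : S × Y × Z → ℝ}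
    (h : margSY Q = margSY P) : π.errorProb Q = π.errorProb P := by
  simp only [errorProb, sum_eve_law, h]

theorem keyLength_le (π : OneWayProtocol S Y n m) {Q : S × Y × Z → ℝ}
    (hQ : Q ∈ stdSimplex ℝ (S × Y × Z)) :
    (m : ℝ) ≤ π.leakage Q + n * condMutualInfo Q + 1 + π.errorProb Q * m := by
  have hcard : Real.logb 2 (Fintype.card (Fin m → Bool)) = m := by
    simp [Real.logb_pow]
  have h := condEntropy_key_le (iidLaw_mem_stdSimplex hQ n) π.alice_mem π.bob_mem
  rw [condMutualInfo_iidLaw hQ.2, hcard] at h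
  have hl : π.leakage Q = m - condEntropy (fun p : (Fin m → Bool) × ((Fin n → Z) × Fin π.msgs) =>
      ∑ kB, π.law Q p.1 kB p.2.1 p.2.2) := by rw [leakage, hcard]
  have he : π.errorProb Q = ∑ kA, ∑ kB, if kA ≠ kB then ∑ z, ∑ c, π.law Q kA kB z c else 0 := rfl
  rw [hl, he]
  simp only [law]
  simp only [iidLaw] at h
  linarith

end OneWayProtocol

/-! ### The asymptotic bound and its minimization over `Δ_P` -/

variable {S Y Z : Type*} [Fintype S] [Fintype Y] [Fintype Z]

theorem Distills.of_sameMarginals {P Q : S × Y × Z → ℝ} (hQ : Q ∈ sameMarginals P)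
    {m : ℕ → ℕ} {π : ∀ n, OneWayProtocol S Y n (m n)} {R : ℝ} (h : Distills P π R) :
    Distills Q π R := by
  simpa only [Distills, OneWayProtocol.errorProb_congr _ hQ.2.1,
    OneWayProtocol.leakage_congr _ hQ.2.2] using h

theorem Distills.rate_le_condMutualInfo {Q : S × Y × Z → ℝ} (hQ : Q ∈ stdSimplex ℝ (S × Y × Z))
    {m : ℕ → ℕ} {π : ∀ n, OneWayProtocol S Y n (m n)} {R : ℝ} (h : Distills Q π R) :
    R ≤ condMutualInfo Q := by
  obtain ⟨he, hl, hm⟩ := h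
  -- The Fano term grows with `m n`, so it is moved to the left; since `m n / n` converges, the
  -- factor `1 - errorProb` disappears in the limit.
  have h1 : Tendsto (fun n => (m n : ℝ) / n * (1 - (π n).errorProb Q)) atTop (𝓝 (R * (1 - 0))) :=
    hm.mul (tendsto_const_nhds.sub he)
  have h2 : Tendsto (fun n : ℕ => ((π n).leakage Q + 1) * (n : ℝ)⁻¹ + condMutualInfo Q) atTop
      (𝓝 ((0 + 1) * 0 + condMutualInfo Q)) :=
    ((hl.add_const 1).mul tendsto_inv_atTop_nhds_zero_nat).add_const _
  have h3 := le_of_tendsto_of_tendsto h1 h2 <| by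
    filter_upwards [eventually_gt_atTop 0] with n hn
    have hn : (0 : ℝ) < n := by exact_mod_cast hn
    have := (π n).keyLength_le hQ
    rw [div_mul_eq_mul_div, div_le_iff₀ hn, add_mul, mul_assoc, inv_mul_cancel₀ hn.ne']
    linarith
  simpa using h3

theorem Distills.rate_le_uniqueInfo {P : S × Y × Z → ℝ} (hP : P ∈ stdSimplex ℝ (S × Y × Z))
    {m : ℕ → ℕ} {π : ∀ n, OneWayProtocol S Y n (m n)} {R : ℝ} (h : Distills P π R) :
    R ≤ uniqueInfo P := by
  obtain ⟨Q, hQ, hmin⟩ := (uniqueInfo_isLeast P hP).1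
  rw [← hmin]
  exact (h.of_sameMarginals hQ).rate_le_condMutualInfo hQ.1

theorem oneWayKeyRate_le_oneWayKeyRateRandomized (P : S × Y × Z → ℝ) :
    oneWayKeyRate P ≤ oneWayKeyRateRandomized P :=
  sSup_le_sSup fun _ ⟨R, m, π, _, h, hr⟩ => ⟨R, m, π, h, hr⟩

theorem oneWayKeyRateRandomized_le_uniqueInfo {P : S × Y × Z → ℝ}
    (hP : P ∈ stdSimplex ℝ (S × Y × Z)) :
    oneWayKeyRateRandomized P ≤ (uniqueInfo P : EReal) := by
  refine sSup_le ?_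
  rintro _ ⟨R, m, π, h, rfl⟩
  exact EReal.coe_le_coe_iff.2 (h.rate_le_uniqueInfo hP)

end KeyRate

theorem mainTheorem1 {S Y Z : Type*} [Fintype S] [Fintype Y] [Fintype Z]
    (P : S × Y × Z → ℝ) (hP : P ∈ stdSimplex ℝ (S × Y × Z)) :
    KeyRate.oneWayKeyRate P ≤ (KeyRate.uniqueInfo P : EReal) ∧
      KeyRate.oneWayKeyRateRandomized P ≤ (KeyRate.uniqueInfo P : EReal) :=
  have h := KeyRate.oneWayKeyRateRandomized_le_uniqueInfo hP
  ⟨(KeyRate.oneWayKeyRate_le_oneWayKeyRateRandomized P).trans h, h⟩
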